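/- Let $p$ be a prime and let $G$ be a metabelian group of order $p^m$ and nilpotency class $c=m-1\ge 3$ (so $G$ has maximal class, i.e. coclass $1$). Write $\gamma_1(G)=G$, $\gamma_{j+1}(G)=[\gamma_j(G),G]$, $G'=\gamma_2(G)$, $[a,b]=a^{-1}b^{-1}ab$, let $\chi_2(G)=\{g\in G\mid [g,u]\in\gamma_4(G)\text{ for all }u\in\gamma_2(G)\}$, and define the invariant $k=k(G)$ by $[\chi_2(G),\gamma_2(G)]=\gamma_{m-k}(G)$, $0\le k\le m-4$. Let $G=\langle x,y\rangle$ with $x\in G\setminus\chi_2(G)$ and $y\in\chi_2(G)\setminus G'$. Put $s_2=[y,x]$, $s_j=[s_{j-1},x]$ for $j\ge 3$, and $U_i=\langle g_i,G'\rangle$ for $1\le i\le p+1$, where $g_1=y$ and $g_i=xy^{i-2}$ for $2\le i\le p+1$. For $U\le G$ let $T_{G,U}\colon G\to U/U'$ be the Artin transfer. Let $\pi\colon G\to H=G/\gamma_c(G)$ be the projection onto the parent and put $V_i=\pi(U_i)$, $$\mathrm{Stb}_\pi(G)=\{1\le i\le p+1\mid \ker\pi\le U_i'\},\qquad \mathrm{Pol}_\pi(G)=\{1\le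 i\le p+1\mid \ker\pi\not\le U_i'\}.$$ Then: (0) $G/G'$ is of type $(p,p)$; the subgroups $U_1,\dots,U_{p+1}$ are pairwise distinct and are exactly the maximal subgroups of $G$; and $k$ is well defined, i.e. $[\chi_2(G),\gamma_2(G)]=\gamma_{m-k}(G)$ for a unique $k$ with $0\le k\le m-4$. (1) The components of the Artin pattern $\bigl((U_i/U_i')_i,(\ker T_{G,U_i})_i\bigr)$ with $i\in\mathrm{Stb}_\pi(G)$ remain fixed: the epimorphism $U_i/U_i'\to V_i/V_i'$ induced by $\pi$ is an isomorphism and $\pi(\ker T_{G,U_i})=\ker T_{H,V_i}$. For $i\in\mathrm{Pol}_\pi(G)$, $V_i/V_i'$ is the quotient of $U_i/U_i'$ by the kernel of the induced epimorphism, this epimorphism is not an isomorphism, and $\pi(\ker T_{G,U_i})\le\ker T_{H,V_i}$. (2) (Unipolarization and partial stabilization.) If $U_1$ is abelian, then $\mathrm{Pol}_\pi(G)=\{1\}$ and $\mathrm{Stb}_\pi(G)=\{2,\dots,p+1\}$. More precisely, $$\mathrm{Pol}_\pi(G)=\{1\},\ \mathrm{Stb}_\pi(G)=\{2,\dots,p+1\}\iff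 U_1'=1,\ k=0.$$ (3) (Nilpolarization and total stabilization.) If all maximal subgroups $U_1,\dots,U_{p+1}$ are non-abelian, then $\mathrm{Pol}_\pi(G)=\emptyset$ and $\mathrm{Stb}_\pi(G)=\{1,\dots,p+1\}$. More precisely, $$\mathrm{Pol}_\pi(G)=\emptyset,\ \mathrm{Stb}_\pi(G)=\{1,\dots,p+1\}\iff U_1'=\langle s_{m-k},\dots,s_{m-1}\rangle=\gamma_{m-k}(G),\ k\ge 1.$$ (4) In both cases, $U_i'=\langle s_3,\dots,s_{m-1}\rangle=\gamma_3(G)$ for $2\le i\le p+1$. -/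

import Mathlib

namespace MaxClass

/-! ### Artin transfers and Artin patterns -/

section Artin

variable {G H ι : Type*} [Group G] [Group H]

/-- The Artin transfer `T_{G,U} : G → U / U'` to the abelianization of a subgroup of finite index. -/
noncomputable def artinTransfer (U : Subgroup G) [U.FiniteIndex] : G →* Abelianization U :=
  MonoidHom.transfer (Abelianization.of : U →* Abelianization U)

/-- The transfer target type `τ(G) = (U_i / U_i')_i` of `G` with respect to a family of subgroups. -/
abbrev transferTargetType (U : ι → Subgroup G) (i : ι) : Type _ :=
  Abelianization (U i)

/-- The transfer kernel type `ϰ(G) = (ker T_{G,U_i})_i` of `G` with respect to a family of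
subgroups of finite index. -/
noncomputable def transferKernelType (U : ι → Subgroup G) [∀ i, (U i).FiniteIndex] (i : ι) :
    Subgroup G :=
  (artinTransfer (U i)).ker

/-- The family of images `V_i = φ(U_i)`. -/
abbrev imageFamily (φ : G →* H) (U : ι → Subgroup G) (i : ι) : Subgroup H :=
  (U i).map φ

/-- The epimorphism `U_i / U_i' → V_i / V_i'`, `x U_i' ↦ φ(x) V_i'`, induced by `φ`,
where `V_i = φ(U_i)`. -/
def inducedTarget (φ : G →* H) (U : ι → Subgroup G) (i : ι) :
    transferTargetType U i →* transferTargetType (imageFamily φ U) i :=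
  Abelianization.map (φ.subgroupMap (U i))

/-- Precedence of the `i`-th targets:
`V_i / V_i' ⪯ U_i / U_i'` iff `V_i / V_i' ≃ (U_i / U_i') / ker`. -/
def TargetPrec (φ : G →* H) (U : ι → Subgroup G) (i : ι) : Prop :=
  Nonempty (transferTargetType (imageFamily φ U) i ≃*
    transferTargetType U i ⧸ (inducedTarget φ U i).ker)

/-- Equality of the `i`-th targets: the induced epimorphism is an isomorphism. -/
def TargetEq (φ : G →* H) (U : ι → Subgroup G) (i : ι) : Prop :=
  Function.Bijective (inducedTarget φ U i)

/-- Precedence of the `i`-th kernels: `φ(ker T_{G,U_i}) ≤ ker T_{H,V_i}`. -/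
def KernelPrec (φ : G →* H) (U : ι → Subgroup G) [∀ i, (U i).FiniteIndex]
    [∀ i, (imageFamily φ U i).FiniteIndex] (i : ι) : Prop :=
  (transferKernelType U i).map φ ≤ transferKernelType (imageFamily φ U) i

/-- Equality of the `i`-th kernels: `φ(ker T_{G,U_i}) = ker T_{H,V_i}`. -/
def KernelEq (φ : G →* H) (U : ι → Subgroup G) [∀ i, (U i).FiniteIndex]
    [∀ i, (imageFamily φ U i).FiniteIndex] (i : ι) : Prop :=
  (transferKernelType U i).map φ = transferKernelType (imageFamily φ U) i

/-- The stable part `Stb_φ(G) = {i ∈ I | ker φ ≤ U_i'}` of the Artin pattern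
with respect to the subgroups `U_i`, `i ∈ I`. -/
def Stb (φ : G →* H) (I : Set ι) (U : ι → Subgroup G) : Set ι :=
  {i ∈ I | φ.ker ≤ ⁅U i, U i⁆}

/-- The polarized part `Pol_φ(G) = {i ∈ I | ¬ ker φ ≤ U_i'}` of the Artin pattern
with respect to the subgroups `U_i`, `i ∈ I`. -/
def Pol (φ : G →* H) (I : Set ι) (U : ι → Subgroup G) : Set ι :=
  {i ∈ I | ¬ φ.ker ≤ ⁅U i, U i⁆}

end Artin

/-! ### Groups of maximal class -/

section Groups

/-- The lower central series with `γ_1(G) = G` and `γ_{j+1}(G) = [γ_j(G), G]`. -/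
abbrev gamma (G : Type*) [Group G] (j : ℕ) : Subgroup G :=
  (⊤ : Subgroup G).lowerCentralSeries (j - 1)

/-- The natural projection `π : G → G / γ_c(G)` onto the parent, where `c` is the nilpotency class
of `G`. -/
noncomputable def parentProj (G : Type*) [Group G] : G →* G ⧸ gamma G (Group.nilpotencyClass G) :=
  QuotientGroup.mk' (gamma G (Group.nilpotencyClass G))

/-- The two-step centralizer `χ_2(G)`: the preimage in `G` of the centralizer of
`γ_2(G) / γ_4(G)` in `G / γ_4(G)`. -/
def chi2 (G : Type*) [Group G] : Subgroup G :=
  (Subgroup.centralizer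
    ((gamma G 2).map (QuotientGroup.mk' (gamma G 4)) : Set (G ⧸ gamma G 4))).comap
      (QuotientGroup.mk' (gamma G 4))

/-- The invariant `k = k(G)` with `[χ_2(G), γ_2(G)] = γ_{m-k}(G)`,
where `m - 1` is the nilpotency class of `G`. -/
noncomputable def defect (G : Type*) [Group G] : ℕ :=
  sInf {k : ℕ | ⁅chi2 G, gamma G 2⁆ = gamma G (Group.nilpotencyClass G + 1 - k)}

variable {G : Type*} [Group G]

/-- The commutator `[a, b] = a⁻¹ b⁻¹ a b`. -/
def comm (a b : G) : G := a⁻¹ * b⁻¹ * a * b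

/-- The higher commutators `s_2 = [y, x]` and `s_j = [s_{j-1}, x]` for `j ≥ 3`
(with `s_1 = y`, and an unused value at `0`). -/
def s (x y : G) : ℕ → G
  | 0 => y
  | 1 => y
  | j + 2 => comm (s x y (j + 1)) x

/-- The generators `g_1 = y` and `g_i = x y^{i-2}` for `i ≥ 2`. -/
def g (x y : G) (i : ℕ) : G := if i = 1 then y else x * y ^ (i - 2)

/-- The subgroups `U_i = ⟨g_i, G'⟩`. -/
def U (x y : G) (i : ℕ) : Subgroup G := Subgroup.zpowers (g x y i) ⊔ commutator G

end Groups

end MaxClass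

namespace MaxClass

/-! ### Transfers under epimorphisms -/

section Transfer

open Subgroup

variable {G K A B : Type*} [Group G] [Group K] [CommGroup A] [CommGroup B]

/-! Everything reduces to whether `ker π = γ_{m-1}` lies in `U_i'`. Transfers are natural: if `ker φ
≤ U`, the induced map on abelianizations carries `T_{G,U}` to `T_{H,φ(U)} ∘ φ`
(`inducedTarget_artinTransfer`), so kernels map into kernels. The induced map is bijective exactly
when `ker φ ≤ U'` (`targetEq_iff`), and then the kernels correspond.

It remains to find `U_i'`. In maximal class `γ_j / γ_{j+1}` has order `p` for `2 ≤ j < m`, so every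
normal subgroup inside `G'` is some `γ_j` (`exists_eq_gamma_of_normal`). Since `U_i / G'` is cyclic,
`U_i' = [U_i, G']`. As `U_1 = χ_2(G)`, the group `U_1'` lies in `γ_4`, so it equals `γ_{m-k}` with
`k ≤ m - 4` (`defect_spec`). For `i ≥ 2`, `G = U_i U_1` gives `γ_3 = [U_i, G'] [U_1, G']` with
second factor in `γ_4`, which forces `U_i' = γ_3` (`commutator_U_eq_gamma_three`). Hence every `i ≥
2` is stable because `m - 1 ≥ 3`, while `1` is stable iff `k ≥ 1`. -/

theorem transfer_eq_prod {H : Subgroup G} [H.FiniteIndex] [Fintype (G ⧸ H)] (ϕ : H →* A)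
    (σ : G ⧸ H → G) (hσ : ∀ q, (σ q : G ⧸ H) = q) (g : G) :
    MonoidHom.transfer ϕ g = ∏ q : G ⧸ H, ϕ ⟨(σ q)⁻¹ * (g * σ (g⁻¹ • q)),
      QuotientGroup.eq.mp (by
        rw [hσ, ← smul_eq_mul, ← MulAction.Quotient.smul_coe, hσ, smul_inv_smul])⟩ := by
  obtain rfl : ‹Fintype (G ⧸ H)› = H.fintypeQuotientOfFiniteIndex := Subsingleton.elim _ _
  rw [MonoidHom.transfer_def ϕ ⟨Set.range σ, isComplement_range_left hσ⟩, leftTransversals.diff]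
  let _ := H.fintypeQuotientOfFiniteIndex
  refine Fintype.prod_equiv (Equiv.refl _) _ _ fun q => congrArg ϕ (Subtype.ext ?_)
  simp only [smul_apply_eq_smul_apply_inv_smul, IsComplement.leftQuotientEquiv_apply hσ,
    smul_eq_mul, Equiv.refl_apply]

theorem map_transfer {H : Subgroup G} [H.FiniteIndex] (ϕ : H →* A) (f : A →* B) (g : G) :
    f (MonoidHom.transfer ϕ g) = MonoidHom.transfer (f.comp ϕ) g := by
  have := H.fintypeQuotientOfFiniteIndex
  rw [transfer_eq_prod ϕ Quotient.out Quotient.out_eq',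
    transfer_eq_prod (f.comp ϕ) Quotient.out Quotient.out_eq', map_prod]
  rfl

/-- Because `ker φ ≤ H`, `φ` induces a bijection of cosets `G ⧸ H ≃ K ⧸ φ(H)`. A section upstairs
therefore pushes forward to a section downstairs, and the two transfer products agree factor by
factor. -/
theorem transfer_comp_subgroupMap {H : Subgroup G} [H.FiniteIndex] (φ : G →* K)
    (hφ : Function.Surjective φ) (hker : φ.ker ≤ H) [(H.map φ).FiniteIndex]
    (ϕ : H.map φ →* A) (g : G) :
    MonoidHom.transfer (ϕ.comp (φ.subgroupMap H)) g = MonoidHom.transfer ϕ (φ g) := by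
  have := H.fintypeQuotientOfFiniteIndex
  have := (H.map φ).fintypeQuotientOfFiniteIndex
  have hmem : ∀ a : G, φ a ∈ H.map φ ↔ a ∈ H := fun a => by
    rw [← mem_comap, comap_map_eq_self hker]
  let e₀ : G ⧸ H → K ⧸ H.map φ := Quotient.map' φ fun a b h => by
    rw [QuotientGroup.leftRel_apply] at h ⊢
    rw [← map_inv, ← map_mul]
    exact (hmem _).2 h
  have he₀ : ∀ a : G, e₀ (a : G ⧸ H) = (φ a : K ⧸ H.map φ) := fun _ => rfl
  have hbij : Function.Bijective e₀ := by
    constructor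
    · intro a b
      induction a using QuotientGroup.induction_on
      induction b using QuotientGroup.induction_on
      rw [he₀, he₀, QuotientGroup.eq, QuotientGroup.eq, ← map_inv, ← map_mul]
      exact (hmem _).1
    · intro b
      induction b using QuotientGroup.induction_on with
      | H b =>
        obtain ⟨a, rfl⟩ := hφ b
        exact ⟨a, rfl⟩
  let e := Equiv.ofBijective e₀ hbij
  have he : ∀ a : G, e (a : G ⧸ H) = (φ a : K ⧸ H.map φ) := he₀
  have hout : ∀ q : G ⧸ H, (q.out : G ⧸ H) = q := Quotient.out_eq'
  have hσ : ∀ q : K ⧸ H.map φ, (φ (e.symm q).out : K ⧸ H.map φ) = q := fun q => by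
    rw [← he, hout, e.apply_symm_apply]
  rw [transfer_eq_prod _ Quotient.out hout, transfer_eq_prod ϕ (fun q => φ (e.symm q).out) hσ]
  refine Fintype.prod_equiv e _ _ fun q => congrArg ϕ (Subtype.ext ?_)
  have hsmul : e.symm ((φ g)⁻¹ • e q) = g⁻¹ • q := by
    rw [Equiv.symm_apply_eq]
    induction q using QuotientGroup.induction_on with
    | H a =>
      rw [MulAction.Quotient.smul_coe, he, he, MulAction.Quotient.smul_coe, smul_eq_mul,
        smul_eq_mul, map_mul, map_inv]
  simp only [e.symm_apply_apply, hsmul, MonoidHom.subgroupMap_apply_coe, map_mul, map_inv]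

end Transfer

/-! ### Artin patterns under epimorphisms -/

section ArtinPattern

open Subgroup

variable {G H ι : Type*} [Group G] [Group H] (φ : G →* H) (U : ι → Subgroup G) (i : ι)

theorem inducedTarget_surjective : Function.Surjective (inducedTarget φ U i) := by
  intro b
  obtain ⟨b, rfl⟩ := QuotientGroup.mk_surjective b
  obtain ⟨a, rfl⟩ := φ.subgroupMap_surjective (U i) b
  exact ⟨Abelianization.of a, rfl⟩

theorem targetPrec : TargetPrec φ U i :=
  ⟨(QuotientGroup.quotientKerEquivOfSurjective _ (inducedTarget_surjective φ U i)).symm⟩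

theorem mem_commutator_subgroup_iff {V : Subgroup G} (a : V) :
    a ∈ commutator V ↔ (a : G) ∈ ⁅V, V⁆ := by
  rw [← map_subtype_commutator, ← V.subtype_apply, mem_map_iff_mem V.subtype_injective]

theorem of_eq_one_iff {V : Subgroup G} (a : V) :
    Abelianization.of a = 1 ↔ (a : G) ∈ ⁅V, V⁆ := by
  rw [← MonoidHom.mem_ker, Abelianization.ker_of, mem_commutator_subgroup_iff]

/-- The kernel of the induced epimorphism is `(ker φ · U_i') / U_i'`. -/
theorem targetEq_iff (hker : φ.ker ≤ U i) : TargetEq φ U i ↔ φ.ker ≤ ⁅U i, U i⁆ := by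
  constructor
  · intro h z hz
    rw [← of_eq_one_iff (⟨z, hker hz⟩ : U i)]
    refine h.1 ?_
    rw [map_one]
    change Abelianization.of (φ.subgroupMap (U i) ⟨z, hker hz⟩) = 1
    rw [show φ.subgroupMap (U i) ⟨z, hker hz⟩ = 1 from Subtype.ext hz, map_one]
  · intro h
    refine ⟨(injective_iff_map_eq_one _).2 fun a ha => ?_, inducedTarget_surjective φ U i⟩
    obtain ⟨a, rfl⟩ := QuotientGroup.mk_surjective a
    change Abelianization.of (φ.subgroupMap (U i) a) = 1 at ha
    rw [of_eq_one_iff, ← map_commutator, MonoidHom.subgroupMap_apply_coe, ← mem_comap,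
      comap_map_eq_self h] at ha
    exact (of_eq_one_iff a).2 ha

variable [∀ i, (U i).FiniteIndex] [∀ i, (imageFamily φ U i).FiniteIndex]

theorem inducedTarget_artinTransfer (hφ : Function.Surjective φ) (hker : φ.ker ≤ U i) (g : G) :
    inducedTarget φ U i (artinTransfer (U i) g) = artinTransfer (imageFamily φ U i) (φ g) := by
  refine (map_transfer _ _ g).trans ?_
  exact transfer_comp_subgroupMap φ hφ hker Abelianization.of g

theorem kernelPrec (hφ : Function.Surjective φ) (hker : φ.ker ≤ U i) : KernelPrec φ U i := by
  rintro _ ⟨g, hg, rfl⟩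
  have hg' : artinTransfer (U i) g = 1 := hg
  change artinTransfer (imageFamily φ U i) (φ g) = 1
  rw [← inducedTarget_artinTransfer φ U i hφ hker, hg', map_one]

theorem kernelEq (hφ : Function.Surjective φ) (hker : φ.ker ≤ ⁅U i, U i⁆) : KernelEq φ U i := by
  have hker' : φ.ker ≤ U i := hker.trans (commutator_le_self _)
  refine le_antisymm (kernelPrec φ U i hφ hker') fun h hh => ?_
  obtain ⟨g, rfl⟩ := hφ h
  refine mem_map_of_mem _ (((targetEq_iff φ U i hker').2 hker).1 ?_)
  rw [map_one, inducedTarget_artinTransfer φ U i hφ hker']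
  exact hh

end ArtinPattern

end MaxClass

namespace MaxClass

/-! ### Commutator subgroups modulo a normal subgroup -/

section Commutators

open Subgroup
open scoped commutatorElement

variable {G : Type*} [Group G] {N A B C : Subgroup G}

theorem normal_of_commutator_top_le (hBN : ⁅B, (⊤ : Subgroup G)⁆ ≤ N) (hNA : N ≤ A) (hAB : A ≤ B) :
    A.Normal :=
  commutator_top_right_le_iff.1 ((commutator_mono hAB le_rfl).trans (hBN.trans hNA))

variable [N.Normal]

/-- Turns a commutator bound modulo `N` into containment of `A` in one fixed subgroup, so that it
passes to suprema and closures in the first argument. -/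
theorem commutator_le_iff_le_comap_centralizer :
    ⁅A, C⁆ ≤ N ↔
      A ≤ (centralizer (C.map (QuotientGroup.mk' N) : Set (G ⧸ N))).comap (QuotientGroup.mk' N) := by
  rw [← map_le_iff_le_comap, ← commutator_eq_bot_iff_le_centralizer, ← map_commutator,
    Subgroup.map_eq_bot_iff, QuotientGroup.ker_mk']

theorem sup_commutator_le (hA : ⁅A, C⁆ ≤ N) (hB : ⁅B, C⁆ ≤ N) : ⁅A ⊔ B, C⁆ ≤ N := by
  rw [commutator_le_iff_le_comap_centralizer] at *
  exact sup_le hA hB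

theorem closure_commutator_le {S : Set G} (h : ∀ a ∈ S, ∀ c ∈ C, ⁅a, c⁆ ∈ N) :
    ⁅closure S, C⁆ ≤ N := by
  rw [commutator_le_iff_le_comap_centralizer, closure_le]
  refine fun a ha => SetLike.mem_coe.2 ((zpowers_le).1 ?_)
  rw [← commutator_le_iff_le_comap_centralizer]
  rw [commutator_le]
  intro b hb c hc
  have : zpowers a ≤ (centralizer (C.map (QuotientGroup.mk' N) : Set (G ⧸ N))).comap
      (QuotientGroup.mk' N) := by
    rw [zpowers_le, mem_comap, mem_centralizer_iff]
    rintro _ ⟨c, hc, rfl⟩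
    have := (QuotientGroup.eq_one_iff (N := N) _).2 (h a ha c hc)
    exact (commutatorElement_eq_one_iff_mul_comm.1
      ((map_commutatorElement (QuotientGroup.mk' N) a c).symm.trans this)).symm
  exact commutator_le.1 (commutator_le_iff_le_comap_centralizer.2 this) b hb c hc

theorem closure_commutator_closure_le {S T : Set G} (h : ∀ a ∈ S, ∀ b ∈ T, ⁅a, b⁆ ∈ N) :
    ⁅closure S, closure T⁆ ≤ N := by
  refine closure_commutator_le fun a ha c hc => ?_
  induction hc using closure_induction with
  | mem b hb => exact h a ha b hb
  | one => rw [commutatorElement_one_right]; exact one_mem N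
  | mul b c _ _ hb hc =>
    rw [commutatorElement_mul_right_eq_mul_conj, mul_assoc, mul_assoc, ← mul_assoc b]
    exact mul_mem hb (Normal.conj_mem inferInstance _ hc _)
  | inv b _ hb =>
    rw [commutatorElement_inv_right, ← commutatorElement_inv a b]
    simpa using Normal.conj_mem (inferInstance : N.Normal) _ (inv_mem hb) b⁻¹

/-- The words `a⁻¹b⁻¹ab` and `aba⁻¹b⁻¹` are cyclic rotations of each other, hence conjugate. This
bridges the convention of `comm` and that of `⁅a, b⁆`. -/
theorem inv_commutator_inv_mem_iff {a b : G} : ⁅a⁻¹, b⁻¹⁆ ∈ N ↔ ⁅a, b⁆ ∈ N := by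
  rw [commutatorElement_def, commutatorElement_def, inv_inv, inv_inv, mul_assoc, mul_assoc (a * b),
    Normal.mem_comm_iff inferInstance]

theorem commutator_zpowers_self (a : G) : ⁅zpowers a, zpowers a⁆ = ⊥ := by
  rw [commutator_self_eq_bot_iff]
  infer_instance

/-- If `A / B` is cyclic, then `A' = [A, B]`. -/
theorem commutator_zpowers_sup (a : G) [B.Normal] [(zpowers a ⊔ B).Normal] :
    ⁅zpowers a ⊔ B, zpowers a ⊔ B⁆ = ⁅zpowers a ⊔ B, B⁆ := by
  refine le_antisymm ?_ (commutator_mono le_rfl le_sup_right)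
  refine sup_commutator_le ?_ (commutator_comm_le _ _)
  rw [commutator_comm]
  refine sup_commutator_le ?_ ?_
  · rw [commutator_zpowers_self]
    exact bot_le
  · rw [commutator_comm]
    exact commutator_mono le_sup_left le_rfl

/-- The three subgroups lemma modulo a normal subgroup. -/
theorem commutator_commutator_le_of_rotate (h₁ : ⁅⁅B, C⁆, A⁆ ≤ N) (h₂ : ⁅⁅C, A⁆, B⁆ ≤ N) :
    ⁅⁅A, B⁆, C⁆ ≤ N := by
  rw [← QuotientGroup.ker_mk' N, ← Subgroup.map_eq_bot_iff, map_commutator, map_commutator]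
    at h₁ h₂ ⊢
  exact commutator_commutator_eq_bot_of_rotate h₁ h₂

end Commutators

/-! ### Elementary abelian groups of rank two -/

theorem nonempty_addEquiv_zmod_prod {p : ℕ} [Fact p.Prime] {A : Type*} [AddCommGroup A]
    [Module (ZMod p) A] [Module.Finite (ZMod p) A] (hcard : Nat.card A = p ^ 2) :
    Nonempty (A ≃+ ZMod p × ZMod p) := by
  have h := Module.natCard_eq_pow_finrank (K := ZMod p) (V := A)
  rw [Nat.card_zmod, hcard] at h
  have hrank : Module.finrank (ZMod p) A = 2 :=
    (Nat.pow_right_injective (Fact.out : p.Prime).two_le h).symm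
  obtain ⟨e⟩ := FiniteDimensional.nonempty_linearEquiv_of_finrank_eq (R := ZMod p)
    (M := A) (M' := ZMod p × ZMod p) (by rw [hrank]; simp)
  exact ⟨e.toAddEquiv⟩

theorem nonempty_mulEquiv_zmod_prod {p : ℕ} (hp : p.Prime) {A : Type*} [CommGroup A] [Finite A]
    (hcard : Nat.card A = p ^ 2) (hpow : ∀ a : A, a ^ p = 1) :
    Nonempty (A ≃* Multiplicative (ZMod p × ZMod p)) := by
  have := Fact.mk hp
  let _ := AddCommGroup.zmodModule (n := p) (G := Additive A) hpow
  obtain ⟨e⟩ := nonempty_addEquiv_zmod_prod (p := p) (A := Additive A) hcard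
  exact ⟨AddEquiv.toMultiplicativeRight e⟩

/-! ### The lower central series -/

section LowerCentralSeries

open Subgroup
open scoped commutatorElement

variable {G : Type*} [Group G]

theorem gamma_succ {j : ℕ} (hj : 1 ≤ j) : gamma G (j + 1) = ⁅gamma G j, ⊤⁆ := by
  obtain ⟨i, rfl⟩ := Nat.exists_eq_add_of_le' hj
  rfl

theorem gamma_two : gamma G 2 = commutator G := rfl

theorem gamma_antitone : Antitone (gamma G) := fun _ _ h =>
  Subgroup.lowerCentralSeries_antitone _ (Nat.sub_le_sub_right h 1)

theorem s_succ {j : ℕ} (hj : 1 ≤ j) (x y : G) : s x y (j + 1) = ⁅(s x y j)⁻¹, x⁻¹⁆ := by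
  obtain ⟨i, rfl⟩ := Nat.exists_eq_add_of_le' hj
  simp [s, comm, commutatorElement_def]

theorem s_mem_gamma (x y : G) {j : ℕ} (hj : 1 ≤ j) : s x y j ∈ gamma G j := by
  induction j, hj using Nat.le_induction with
  | base => exact mem_top _
  | succ j hj ih =>
    rw [s_succ hj, gamma_succ hj]
    exact commutator_mem_commutator (inv_mem ih) (mem_top _)

theorem commutator_chi2_le : ⁅chi2 G, gamma G 2⁆ ≤ gamma G 4 :=
  commutator_le_iff_le_comap_centralizer.2 le_rfl

theorem commutator_commutator_eq_bot (h : derivedSeries G 2 = ⊥) :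
    ⁅commutator G, commutator G⁆ = ⊥ := h

theorem commutator_le_chi2 (h : derivedSeries G 2 = ⊥) : commutator G ≤ chi2 G := by
  refine commutator_le_iff_le_comap_centralizer.1 ?_
  exact (commutator_commutator_eq_bot h).le.trans bot_le

/-- Three subgroups lemma: of the two rotations of `[[γ_j, G], χ_2]`, one lies in `[G', G'] = 1` and
the other in `[γ_{j+2}, G]` by induction. -/
theorem commutator_gamma_chi2_le (h : derivedSeries G 2 = ⊥) {j : ℕ} (hj : 2 ≤ j) :
    ⁅gamma G j, chi2 G⁆ ≤ gamma G (j + 2) := by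
  induction j, hj using Nat.le_induction with
  | base =>
    rw [commutator_comm]
    exact commutator_chi2_le
  | succ j hj ih =>
    rw [gamma_succ (by omega)]
    refine commutator_commutator_le_of_rotate ?_ ?_
    · refine le_trans (commutator_mono (commutator_mono le_rfl le_top) (gamma_antitone hj)) ?_
      exact (commutator_commutator_eq_bot h).le.trans bot_le
    · rw [commutator_comm (chi2 G), gamma_succ (j := j + 2) (by omega)]
      exact commutator_mono ih le_rfl

theorem g_mem_U (x y : G) (i : ℕ) : g x y i ∈ U x y i :=
  (le_sup_left : zpowers (g x y i) ≤ _) (mem_zpowers _)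

theorem commutator_le_U (x y : G) (i : ℕ) : commutator G ≤ U x y i := le_sup_right

instance U_normal (x y : G) (i : ℕ) : (U x y i).Normal :=
  Subgroup.Normal.of_commutator_le _ (commutator_le_U x y i)

theorem commutator_U_eq (x y : G) (i : ℕ) : ⁅U x y i, U x y i⁆ = ⁅U x y i, gamma G 2⁆ :=
  have : (zpowers (g x y i) ⊔ commutator G).Normal := U_normal x y i
  commutator_zpowers_sup (B := commutator G) (g x y i)

end LowerCentralSeries

end MaxClass

namespace MaxClass

/-! ### Groups of order `p ^ m` and class `m - 1` -/

/-- `G` has order `p ^ m` and nilpotency class `m - 1 ≥ 3`. -/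
structure IsMaximalClass (p m : ℕ) (G : Type*) [Group G] : Prop where
  prime : p.Prime
  four_le : 4 ≤ m
  card_eq : Nat.card G = p ^ m
  nilpotencyClass_eq : Group.nilpotencyClass G = m - 1

namespace IsMaximalClass

open Subgroup
open scoped commutatorElement

variable {p m : ℕ} {G : Type*} [Group G] (h : IsMaximalClass p m G)
include h

theorem finite : Finite G :=
  Nat.finite_of_card_ne_zero (h.card_eq ▸ (pow_pos h.prime.pos m).ne')

theorem isNilpotent : Group.IsNilpotent G :=
  have := h.finite
  have := Fact.mk h.prime
  (IsPGroup.of_card h.card_eq).isNilpotent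

theorem gamma_eq_bot : gamma G m = ⊥ := by
  have := h.isNilpotent
  exact Subgroup.lowerCentralSeries_eq_bot_iff_nilpotencyClass_le.2 h.nilpotencyClass_eq.le

theorem gamma_ne_bot {j : ℕ} (hj : j < m) : gamma G j ≠ ⊥ := by
  have := h.isNilpotent
  have := h.four_le
  rw [Ne, gamma, Subgroup.lowerCentralSeries_eq_bot_iff_nilpotencyClass_le, h.nilpotencyClass_eq]
  omega

/-- One equality would make the series stationary from `j` on, so it could not reach `1` at `m`. -/
theorem gamma_succ_lt {j : ℕ} (hj : 1 ≤ j) (hjm : j < m) : gamma G (j + 1) < gamma G j := by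
  refine lt_of_le_of_ne (gamma_antitone j.le_succ) fun heq => ?_
  have key : ∀ i, j ≤ i → gamma G i = gamma G j := fun i hi => by
    induction i, hi using Nat.le_induction with
    | base => rfl
    | succ i hi ih => rw [gamma_succ (hj.trans hi), ih, ← gamma_succ hj, heq]
  exact h.gamma_ne_bot hjm ((key m hjm.le).symm.trans h.gamma_eq_bot)

theorem gamma_lt {i j : ℕ} (hi : 1 ≤ i) (hij : i < j) (hjm : j ≤ m) : gamma G j < gamma G i :=
  (gamma_antitone hij).trans_lt (h.gamma_succ_lt hi (by omega))

theorem gamma_injOn {i j : ℕ} (hi : 1 ≤ i) (hj : 1 ≤ j) (him : i ≤ m) (hjm : j ≤ m)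
    (heq : gamma G i = gamma G j) : i = j := by
  rcases lt_trichotomy i j with hij | hij | hij
  · exact absurd heq (h.gamma_lt hi hij hjm).ne'
  · exact hij
  · exact absurd heq (h.gamma_lt hj hij him).ne

theorem exists_card_eq (H : Subgroup G) : ∃ a ≤ m, Nat.card H = p ^ a :=
  (Nat.dvd_prime_pow h.prime).1 (h.card_eq ▸ H.card_subgroup_dvd_card)

theorem card_lt_of_lt {H K : Subgroup G} (hHK : H < K) : Nat.card H < Nat.card K := by
  have := h.finite
  refine lt_of_le_of_ne (card_le_of_le hHK.le) fun heq => hHK.ne ?_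
  exact eq_of_le_of_card_ge hHK.le heq.ge

theorem pow_succ_le_card {H K : Subgroup G} (hHK : H < K) {a : ℕ} (ha : p ^ a ≤ Nat.card H) :
    p ^ (a + 1) ≤ Nat.card K := by
  obtain ⟨b, -, hb⟩ := h.exists_card_eq K
  have := ha.trans_lt (h.card_lt_of_lt hHK)
  rw [hb, Nat.pow_lt_pow_iff_right h.prime.one_lt] at this
  rw [hb]
  exact Nat.pow_le_pow_right h.prime.pos this

/-- A cyclic `G / G'` would give `G' = [G, G'] = γ_3`, against strict descent. -/
theorem zpowers_sup_commutator_ne_top (a : G) : zpowers a ⊔ commutator G ≠ ⊤ := fun htop => by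
  have hlt := h.gamma_succ_lt (j := 2) (by omega) (by have := h.four_le; omega)
  have : (zpowers a ⊔ commutator G).Normal := htop ▸ inferInstance
  have heq := commutator_zpowers_sup (B := commutator G) a
  rw [htop, commutator_comm ⊤ (commutator G)] at heq
  exact hlt.ne heq.symm

theorem pow_le_card_gamma {j : ℕ} (hj : 1 ≤ j) (hjm : j ≤ m) :
    p ^ (m - j) ≤ Nat.card (gamma G j) := by
  induction hjm using Nat.decreasingInduction with
  | self =>
    have := h.finite
    simpa using Nat.one_le_iff_ne_zero.2 (Nat.card_pos (α := gamma G m)).ne'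
  | of_succ j hjm ih =>
    have := h.pow_succ_le_card (h.gamma_succ_lt hj hjm) (ih (by omega))
    rwa [show m - (j + 1) + 1 = m - j by omega] at this

/-- Otherwise `G'` has index `1` or `p`, and `G / G'` is cyclic. -/
theorem card_commutator_le : Nat.card (commutator G) ≤ p ^ (m - 2) := by
  have := h.finite
  have := Fact.mk h.prime
  obtain ⟨a, ham, ha⟩ := h.exists_card_eq (commutator G)
  rw [ha]
  refine Nat.pow_le_pow_right h.prime.pos ?_
  by_contra! hlt
  have hmul := (commutator G).card_mul_index
  rw [ha, h.card_eq] at hmul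
  have hindex : (commutator G).index = p ^ (m - a) := by
    refine Nat.eq_of_mul_eq_mul_left (pow_pos h.prime.pos a) ?_
    rw [hmul, ← pow_add, Nat.add_sub_cancel' ham]
  have hcyc : IsCyclic (G ⧸ commutator G) := by
    rcases (show m - a = 0 ∨ m - a = 1 by omega) with h0 | h1
    · rw [h0, pow_zero] at hindex
      have : Subsingleton (G ⧸ commutator G) := (Nat.card_eq_one_iff_unique.1 hindex).1
      infer_instance
    · rw [h1, pow_one] at hindex
      exact isCyclic_of_prime_card hindex
  obtain ⟨q, hq⟩ := hcyc.exists_generator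
  obtain ⟨b, rfl⟩ := QuotientGroup.mk_surjective q
  refine h.zpowers_sup_commutator_ne_top b (eq_top_iff.2 fun c _ => ?_)
  obtain ⟨n, hn⟩ := hq c
  have hn' : ((b ^ n : G) : G ⧸ commutator G) = c := hn
  rw [QuotientGroup.eq] at hn'
  rw [← mul_inv_cancel_left (b ^ n) c]
  exact mul_mem (mem_sup_left (zpow_mem (mem_zpowers b) n)) (mem_sup_right hn')

/-- A squeeze: each strict step costs a factor of at least `p`. Counting up from `γ_m = 1` bounds
the order below, and counting down from the bound on `|G'|` bounds it above. -/
theorem card_gamma {j : ℕ} (hj : 2 ≤ j) (hjm : j ≤ m) : Nat.card (gamma G j) = p ^ (m - j) := by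
  refine le_antisymm ?_ (h.pow_le_card_gamma (by omega) hjm)
  induction j, hj using Nat.le_induction with
  | base => exact h.card_commutator_le
  | succ j hj ih =>
    obtain ⟨a, -, ha⟩ := h.exists_card_eq (gamma G (j + 1))
    have := (h.card_lt_of_lt (h.gamma_succ_lt (j := j) (by omega) hjm)).trans_le (ih (by omega))
    rw [ha, Nat.pow_lt_pow_iff_right h.prime.one_lt] at this
    rw [ha]
    exact Nat.pow_le_pow_right h.prime.pos (by omega)

/-! ### The quotient `G / G'`, maximal subgroups, and normal subgroups inside `G'`. -/

theorem card_quotient_commutator : Nat.card (G ⧸ commutator G) = p ^ 2 := by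
  have hmul := (commutator G).card_mul_index
  have h4 := h.four_le
  rw [← gamma_two, h.card_gamma le_rfl (by omega), h.card_eq] at hmul
  refine Nat.eq_of_mul_eq_mul_left (pow_pos h.prime.pos (m - 2)) (hmul.trans ?_)
  rw [← pow_add, Nat.sub_add_cancel (by omega)]

theorem pow_mem_commutator (a : G) : a ^ p ∈ commutator G := by
  have := h.finite
  have hdvd : orderOf (a : G ⧸ commutator G) ∣ p ^ 2 :=
    h.card_quotient_commutator ▸ orderOf_dvd_natCard _
  obtain ⟨i, hi, hord⟩ := (Nat.dvd_prime_pow h.prime).1 hdvd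
  rw [← QuotientGroup.eq_one_iff, QuotientGroup.mk_pow, ← orderOf_dvd_iff_pow_eq_one, hord]
  rcases (show i ≤ 1 ∨ i = 2 by omega) with h1 | rfl
  · exact (pow_dvd_pow p h1).trans (pow_one p).dvd
  · refine absurd ?_ (h.zpowers_sup_commutator_ne_top a)
    have htop : zpowers (a : G ⧸ commutator G) = ⊤ :=
      eq_top_of_card_eq _ (by rw [Nat.card_zpowers, hord, h.card_quotient_commutator])
    have hmap : (zpowers a).map (QuotientGroup.mk' (commutator G)) = ⊤ := by
      rw [MonoidHom.map_zpowers]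
      exact htop
    rw [← comap_top (QuotientGroup.mk' (commutator G)), ← hmap, comap_map_eq,
      QuotientGroup.ker_mk']

theorem abelianization_type : Nonempty (Abelianization G ≃* Multiplicative (ZMod p × ZMod p)) := by
  have := h.finite
  have : Finite (Abelianization G) := Quotient.finite _
  have hcard : Nat.card (Abelianization G) = p ^ 2 := h.card_quotient_commutator
  refine nonempty_mulEquiv_zmod_prod h.prime hcard fun a => ?_
  obtain ⟨a, rfl⟩ : ∃ b, Abelianization.of b = a := QuotientGroup.mk_surjective a
  rw [← map_pow, ← MonoidHom.mem_ker, Abelianization.ker_of]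
  exact h.pow_mem_commutator a

/-- Starting from `|G'| = p ^ (m - 2)`, two strict inclusions already exhaust `|G| = p ^ m`. -/
theorem isCoatom_zpowers_sup_commutator {a : G} (ha : a ∉ commutator G) :
    IsCoatom (zpowers a ⊔ commutator G) := by
  have := h.finite
  have h4 := h.four_le
  refine ⟨h.zpowers_sup_commutator_ne_top a, fun M hM => ?_⟩
  have hlt : commutator G < zpowers a ⊔ commutator G :=
    lt_of_le_of_ne le_sup_right fun heq => ha (heq.ge (mem_sup_left (mem_zpowers a)))
  have hcard : Nat.card (commutator G) = p ^ (m - 2) := h.card_gamma (j := 2) le_rfl (by omega)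
  have hle := h.pow_succ_le_card hM (h.pow_succ_le_card hlt hcard.ge)
  rw [show m - 2 + 1 + 1 = m by omega] at hle
  exact eq_top_of_le_card _ (h.card_eq.trans_le hle)

/-- The normal subgroups contained in the commutator subgroup are the terms of the lower central
series. -/
theorem eq_gamma_of_normal {N : Subgroup G} [N.Normal] {j : ℕ} (hj : 2 ≤ j) (hjm : j < m)
    (hle : N ≤ gamma G j) (hnle : ¬ N ≤ gamma G (j + 1)) : N = gamma G j := by
  have := h.finite
  have hsup : N ⊔ gamma G (j + 1) = gamma G j := by
    refine eq_of_le_of_card_ge (sup_le hle (gamma_antitone j.le_succ)) ?_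
    have hlt : gamma G (j + 1) < N ⊔ gamma G (j + 1) :=
      lt_of_le_of_ne le_sup_right fun heq => hnle (heq ▸ le_sup_left)
    have := h.pow_succ_le_card hlt (h.card_gamma (by omega) hjm).ge
    rwa [show m - (j + 1) + 1 = m - j by omega, ← h.card_gamma hj hjm.le] at this
  -- If `γ_j ≤ N γ_i`, then `γ_{j+1} = [γ_j, G] ≤ N γ_{i+1}`, and `γ_j = N γ_{j+1}` closes the
  -- induction. At `i = m` the second factor disappears.
  have key : ∀ i, j + 1 ≤ i → gamma G j ≤ N ⊔ gamma G i := fun i hi => by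
    induction i, hi using Nat.le_induction with
    | base => exact hsup.ge
    | succ i hi ih =>
      rw [← hsup]
      refine sup_le le_sup_left ?_
      rw [gamma_succ (by omega)]
      refine (commutator_mono ih le_rfl).trans (sup_commutator_le ?_ ?_)
      · exact (commutator_le_left _ _).trans le_sup_left
      · rw [← gamma_succ (by omega)]
        exact le_sup_right
  refine le_antisymm hle ?_
  simpa [h.gamma_eq_bot] using key m hjm

theorem exists_eq_gamma_of_normal {N : Subgroup G} [N.Normal] {i : ℕ} (hi : 2 ≤ i) (him : i ≤ m)
    (hle : N ≤ gamma G i) : ∃ j, i ≤ j ∧ j ≤ m ∧ N = gamma G j := by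
  induction him using Nat.decreasingInduction with
  | self => exact ⟨m, le_rfl, le_rfl, by rw [h.gamma_eq_bot] at hle ⊢; exact le_bot_iff.1 hle⟩
  | of_succ i him ih =>
    by_cases hle' : N ≤ gamma G (i + 1)
    · obtain ⟨j, hij, hj⟩ := ih (by omega) hle'
      exact ⟨j, by omega, hj⟩
    · exact ⟨i, le_rfl, him.le, h.eq_gamma_of_normal hi him hle hle'⟩

/-- `M` is normal by nilpotency. If `G' ≰ M`, then `M γ_i = G` for every `i ≥ 2`: from `M γ_i = G`
follows `G' = [M γ_i, G] ≤ M γ_{i+1}`, so maximality gives `M γ_{i+1} = G`. At `i = m` this says `M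
= G`. -/
theorem isCoatom_commutator_le {M : Subgroup G} (hM : IsCoatom M) : commutator G ≤ M := by
  have := h.isNilpotent
  have := h.finite
  have : M.Normal := (Group.normalizerCondition_of_isNilpotent).normal_of_coatom M hM
  by_contra hle
  have key : ∀ i, 2 ≤ i → M ⊔ gamma G i = ⊤ := fun i hi => by
    induction i, hi using Nat.le_induction with
    | base => exact hM.2 _ (lt_of_le_of_ne le_sup_left fun heq => hle (heq ▸ le_sup_right))
    | succ i hi ih =>
      refine hM.2 _ (lt_of_le_of_ne le_sup_left fun heq => hle ?_)
      have h2 : commutator G ≤ M ⊔ gamma G (i + 1) := by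
        rw [commutator_def]
        nth_rw 1 [← ih]
        refine sup_commutator_le ?_ ?_
        · exact (commutator_le_left _ _).trans le_sup_left
        · rw [← gamma_succ (by omega)]
          exact le_sup_right
      exact heq ▸ h2
  refine hM.1 ?_
  simpa [h.gamma_eq_bot] using key m (by have := h.four_le; omega)

end IsMaximalClass

end MaxClass

namespace MaxClass

/-! ### Generators adapted to the two-step centralizer -/

/-- Generators `x, y` of a metabelian group of maximal class with `x` outside and `y` inside the
two-step centralizer. -/
structure IsAdapted {G : Type*} [Group G] (x y : G) : Prop where
  metabelian : derivedSeries G 2 = ⊥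
  closure_eq_top : Subgroup.closure {x, y} = ⊤
  left_notMem : x ∉ chi2 G
  right_mem : y ∈ chi2 G
  right_notMem : y ∉ commutator G

namespace IsAdapted

open Subgroup
open scoped commutatorElement

variable {G : Type*} [Group G] {x y : G} (a : IsAdapted x y)
include a

theorem mul_pow_notMem_chi2 (n : ℕ) : x * y ^ n ∉ chi2 G := fun h =>
  a.left_notMem ((mul_mem_cancel_right (pow_mem a.right_mem n)).1 h)

theorem g_notMem_chi2 {i : ℕ} (hi : 2 ≤ i) : g x y i ∉ chi2 G := by
  rw [g, if_neg (by omega)]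
  exact a.mul_pow_notMem_chi2 _

theorem g_notMem_commutator {i : ℕ} (hi : 1 ≤ i) : g x y i ∉ commutator G := by
  rcases hi.eq_or_lt with rfl | hi
  · exact a.right_notMem
  · exact fun h => a.g_notMem_chi2 hi (commutator_le_chi2 a.metabelian h)

/-- Modulo `γ_{j+2}`, commuting `s_j` with `y ∈ χ_2` gives nothing, so only `[s_j, x] = s_{j+1}` is
needed to generate the next factor. -/
theorem gamma_le_zpowers_sup {j : ℕ} (hj : 2 ≤ j) :
    gamma G j ≤ zpowers (s x y j) ⊔ gamma G (j + 1) := by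
  have hnormal : ∀ {j : ℕ}, 1 ≤ j → (zpowers (s x y j) ⊔ gamma G (j + 1)).Normal := fun hj =>
    normal_of_commutator_top_le (gamma_succ hj).ge le_sup_right
      (sup_le (zpowers_le.2 (s_mem_gamma x y hj)) (gamma_antitone (Nat.le_succ _)))
  induction j, hj using Nat.le_induction with
  | base =>
    have := hnormal (j := 2) (by omega)
    have hyx : ⁅y, x⁆ ∈ zpowers (s x y 2) ⊔ gamma G (2 + 1) := by
      rw [← inv_commutator_inv_mem_iff]
      exact mem_sup_left (by rw [s_succ le_rfl]; exact mem_zpowers _)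
    rw [gamma_two, commutator_def, ← a.closure_eq_top]
    refine closure_commutator_closure_le fun b hb c hc => ?_
    rcases hb with rfl | rfl <;> rcases hc with rfl | rfl
    · rw [commutatorElement_self]; exact one_mem _
    · rw [← commutatorElement_inv]; exact inv_mem hyx
    · exact hyx
    · rw [commutatorElement_self]; exact one_mem _
  | succ j hj ih =>
    have := hnormal (j := j + 1) (by omega)
    rw [gamma_succ (j := j) (by omega)]
    refine (commutator_mono ih le_rfl).trans (sup_commutator_le ?_ ?_)
    · rw [← a.closure_eq_top, zpowers_eq_closure]
      refine closure_commutator_closure_le fun b hb c hc => ?_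
      rw [Set.mem_singleton_iff.1 hb]
      rcases hc with rfl | rfl
      · rw [← inv_commutator_inv_mem_iff, ← s_succ (by omega)]
        exact mem_sup_left (mem_zpowers _)
      · exact mem_sup_right (commutator_gamma_chi2_le a.metabelian hj
          (commutator_mem_commutator (s_mem_gamma _ _ (by omega)) a.right_mem))
    · rw [← gamma_succ (j := j + 1) (by omega)]
      exact le_sup_right

variable {p m : ℕ} (h : IsMaximalClass p m G)
include h

theorem gamma_eq_closure {j : ℕ} (hj : 2 ≤ j) (hjm : j ≤ m) :
    gamma G j = closure (s x y '' Set.Icc j (m - 1)) := by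
  refine le_antisymm ?_ ?_
  · induction hjm using Nat.decreasingInduction with
    | self => exact h.gamma_eq_bot.le.trans bot_le
    | of_succ j hjm ih =>
      refine (a.gamma_le_zpowers_sup hj).trans (sup_le ?_ ((ih (by omega)).trans ?_))
      · exact zpowers_le.2 (subset_closure ⟨j, ⟨le_rfl, by omega⟩, rfl⟩)
      · exact closure_mono (Set.image_mono (Set.Icc_subset_Icc_left (Nat.le_succ j)))
  · rw [closure_le]
    rintro _ ⟨i, ⟨hji, -⟩, rfl⟩
    exact gamma_antitone hji (s_mem_gamma x y (by omega))

/-! ### The maximal subgroups `U_i` and their commutator subgroups. -/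

theorem isCoatom_U {i : ℕ} (hi : 1 ≤ i) : IsCoatom (U x y i) :=
  h.isCoatom_zpowers_sup_commutator (a.g_notMem_commutator hi)

theorem chi2_eq_U : chi2 G = U x y 1 := by
  have hle : U x y 1 ≤ chi2 G :=
    sup_le (zpowers_le.2 a.right_mem) (commutator_le_chi2 a.metabelian)
  by_contra hne
  have htop := (a.isCoatom_U h le_rfl).2 _ (lt_of_le_of_ne hle (Ne.symm hne))
  exact a.left_notMem (htop ▸ mem_top x)

theorem U_eq_of_g_mem {M : Subgroup G} (hM : IsCoatom M) {i : ℕ} (hi : 1 ≤ i) (hg : g x y i ∈ M) :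
    U x y i = M := by
  have hle : U x y i ≤ M := sup_le (zpowers_le.2 hg) (h.isCoatom_commutator_le hM)
  by_contra hne
  exact hM.1 ((a.isCoatom_U h hi).2 _ (lt_of_le_of_ne hle hne))

theorem U_ne_U_one {i : ℕ} (hi : 2 ≤ i) : U x y i ≠ U x y 1 := fun heq =>
  a.g_notMem_chi2 hi (by rw [a.chi2_eq_U h, ← heq]; exact g_mem_U x y i)

theorem exists_U_eq {M : Subgroup G} (hM : IsCoatom M) : ∃ i ∈ Set.Icc 1 (p + 1), U x y i = M := by
  by_cases hy : y ∈ M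
  · exact ⟨1, ⟨le_rfl, by omega⟩, a.U_eq_of_g_mem h hM le_rfl hy⟩
  have hcomm := h.isCoatom_commutator_le hM
  have : M.Normal := Normal.of_commutator_le _ hcomm
  have htop : zpowers y ⊔ M = ⊤ :=
    hM.2 _ (lt_of_le_of_ne le_sup_right fun heq => hy (heq.ge (mem_sup_left (mem_zpowers y))))
  obtain ⟨_, ⟨n, rfl⟩, z, hz, hyz⟩ := mem_sup_of_normal_right.1 (htop ▸ mem_top x)
  have hp : (p : ℤ) ≠ 0 := Int.natCast_ne_zero.2 h.prime.ne_zero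
  have h0 := Int.emod_nonneg (-n) hp
  have hlt := Int.emod_lt_of_pos (-n) (Int.natCast_pos.2 h.prime.pos)
  -- From `x = y ^ n z` with `z ∈ M`, the product `x y ^ (-n)` is a conjugate of `z` and lies in
  -- `M`. Since `y ^ p ∈ G' ≤ M`, the exponent may be reduced modulo `p`; the shift by `2` matches
  -- the indexing of `g`.
  refine ⟨(-n % p).toNat + 2, ⟨by omega, by omega⟩, a.U_eq_of_g_mem h hM (by omega) ?_⟩
  rw [g, if_neg (by omega), Nat.add_sub_cancel, ← zpow_natCast, Int.toNat_of_nonneg h0,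
    Int.emod_def, zpow_sub, zpow_mul, zpow_natCast, ← mul_assoc]
  refine mul_mem ?_ (inv_mem (zpow_mem (hcomm (h.pow_mem_commutator y)) _))
  rw [← hyz, zpow_neg]
  exact Normal.conj_mem inferInstance z hz _

/-- For `i ≥ 2`, equality would put `y ^ (j - i)` in `U_i`, where `0 < j - i < p`. With `y ^ p ∈
G'`, Bézout gives `y ∈ U_i`, hence `U_i = U_1`, which is impossible. -/
theorem U_ne_of_lt {i j : ℕ} (hi : 1 ≤ i) (hij : i < j) (hj : j ≤ p + 1) : U x y i ≠ U x y j := by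
  rcases hi.eq_or_lt with rfl | hi
  · exact (a.U_ne_U_one h hij).symm
  intro heq
  have hgj : g x y j ∈ U x y i := heq ▸ g_mem_U x y j
  have hgi := g_mem_U x y i
  have hpow : y ^ (j - i) ∈ U x y i := by
    have hmul : g x y j = g x y i * y ^ (j - i) := by
      rw [g, g, if_neg (by omega), if_neg (by omega), mul_assoc, ← pow_add]
      congr 2
      omega
    rwa [hmul, mul_mem_cancel_left hgi] at hgj
  have hcop : IsCoprime ((j - i : ℕ) : ℤ) p := Nat.isCoprime_iff_coprime.2
    (Nat.coprime_of_lt_prime (by omega) (by omega) h.prime).symm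
  obtain ⟨b, c, hbc⟩ := hcop
  have hy : y ∈ U x y i := by
    have hmem := mul_mem (zpow_mem hpow b)
      (zpow_mem (commutator_le_U x y i (h.pow_mem_commutator y)) c)
    rwa [← zpow_natCast y (j - i), ← zpow_natCast y p, ← zpow_mul, ← zpow_mul, ← zpow_add,
      mul_comm _ b, mul_comm _ c, hbc, zpow_one] at hmem
  exact a.U_ne_U_one h hi (a.U_eq_of_g_mem h (a.isCoatom_U h (by omega)) le_rfl hy).symm

theorem U_injOn : Set.InjOn (U x y) (Set.Icc 1 (p + 1)) := by
  intro i hi j hj heq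
  rcases lt_trichotomy i j with hij | hij | hij
  · exact absurd heq (a.U_ne_of_lt h hi.1 hij hj.2)
  · exact hij
  · exact absurd heq.symm (a.U_ne_of_lt h hj.1 hij hi.2)

theorem image_U_eq : U x y '' Set.Icc 1 (p + 1) = {M : Subgroup G | IsCoatom M} := by
  ext M
  constructor
  · rintro ⟨i, hi, rfl⟩
    exact a.isCoatom_U h hi.1
  · exact a.exists_U_eq h

theorem commutator_U_eq_gamma_three {i : ℕ} (hi : 2 ≤ i) : ⁅U x y i, U x y i⁆ = gamma G 3 := by
  have h4 := h.four_le
  have htop : U x y i ⊔ U x y 1 = ⊤ := by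
    refine (a.isCoatom_U h (by omega)).2 _ (lt_of_le_of_ne le_sup_left fun heq => ?_)
    exact a.U_ne_U_one h hi
      (a.U_eq_of_g_mem h (a.isCoatom_U h (by omega)) le_rfl
        (heq.ge (mem_sup_right (g_mem_U x y 1)))).symm
  have hg3 : gamma G 3 = ⁅(⊤ : Subgroup G), gamma G 2⁆ := by
    rw [commutator_comm]
    exact gamma_succ (by omega)
  refine h.eq_gamma_of_normal (by omega) (by omega) ?_ fun hle => ?_
  · rw [commutator_U_eq, hg3]
    exact commutator_mono le_top le_rfl
  -- If `U_i' ≤ γ_4`, then `U_i` and `U_1 = χ_2` both centralize `γ_2` modulo `γ_4`, hence so does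
  -- `G`, and `γ_3 ≤ γ_4`.
  · refine (h.gamma_succ_lt (j := 3) (by omega) (by omega)).not_ge ?_
    rw [hg3, ← htop]
    refine sup_commutator_le ((commutator_U_eq x y i).ge.trans hle) ?_
    rw [← a.chi2_eq_U h]
    exact commutator_chi2_le

theorem commutator_chi2_eq : ⁅chi2 G, gamma G 2⁆ = ⁅U x y 1, U x y 1⁆ := by
  rw [a.chi2_eq_U h, commutator_U_eq]

theorem defect_spec : defect G ≤ m - 4 ∧ ⁅U x y 1, U x y 1⁆ = gamma G (m - defect G) := by
  have h4 := h.four_le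
  have hle : ⁅U x y 1, U x y 1⁆ ≤ gamma G 4 := by
    rw [← a.commutator_chi2_eq h]
    exact commutator_chi2_le
  obtain ⟨j, hj, hjm, heq⟩ := h.exists_eq_gamma_of_normal (by omega) h4 hle
  have hdefect : defect G = m - j := by
    rw [defect, a.commutator_chi2_eq h, heq, h.nilpotencyClass_eq, Nat.sub_add_cancel (by omega)]
    have hset : {k : ℕ | gamma G j = gamma G (m - k)} = {m - j} := by
      ext k
      rw [Set.mem_ofPred_eq, Set.mem_singleton_iff]
      constructor
      · intro hk
        -- The infimum in `defect` ranges over all naturals, so truncation for `k ≥ m` must be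
        -- excluded: there `γ_0 = γ_1 = G`, whereas `j ≥ 4`.
        rcases Nat.eq_zero_or_pos (m - k) with h0 | hpos
        · rw [h0] at hk
          have := h.gamma_injOn (i := j) (j := 1) (by omega) le_rfl hjm (by omega) hk
          omega
        · have := h.gamma_injOn (by omega) hpos hjm (by omega) hk
          omega
      · rintro rfl
        rw [Nat.sub_sub_self hjm]
    rw [hset, csInf_singleton]
  rw [hdefect, Nat.sub_sub_self hjm]
  exact ⟨by omega, heq⟩

theorem commutator_U_one_eq_bot_iff : ⁅U x y 1, U x y 1⁆ = ⊥ ↔ defect G = 0 := by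
  obtain ⟨hle, heq⟩ := a.defect_spec h
  have h4 := h.four_le
  rw [heq]
  constructor
  · intro hbot
    by_contra h0
    exact h.gamma_ne_bot (by omega) hbot
  · intro h0
    rw [h0, Nat.sub_zero, h.gamma_eq_bot]

theorem ker_le_commutator_U_one_iff :
    gamma G (m - 1) ≤ ⁅U x y 1, U x y 1⁆ ↔ 1 ≤ defect G := by
  obtain ⟨hle, heq⟩ := a.defect_spec h
  have h4 := h.four_le
  rw [heq]
  constructor
  · intro hk
    by_contra h0
    rw [show m - defect G = m by omega, h.gamma_eq_bot, le_bot_iff] at hk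
    exact h.gamma_ne_bot (by omega) hk
  · exact fun h1 => gamma_antitone (by omega)

end IsAdapted

end MaxClass
-- Stable and polarized parts for the projection onto the parent.
namespace MaxClass

theorem commutator_self_eq_bot_iff_forall {G : Type*} [Group G] {V : Subgroup G} :
    ⁅V, V⁆ = ⊥ ↔ ∀ a ∈ V, ∀ b ∈ V, a * b = b * a := by
  rw [Subgroup.commutator_eq_bot_iff_le_centralizer]
  exact ⟨fun h a ha b hb => (Subgroup.mem_centralizer_iff.1 (h ha) b hb).symm,
    fun h a ha => Subgroup.mem_centralizer_iff.2 fun b hb => h b hb a ha⟩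

end MaxClass

theorem mainTheorem5 (p : ℕ) (hp : p.Prime) (G : Type*) [Group G] [Finite G]
    (m : ℕ) (hm : 3 ≤ m - 1)
    (hcard : Nat.card G = p ^ m)
    (hclass : Group.nilpotencyClass G = m - 1)
    (hmetab : derivedSeries G 2 = ⊥)
    (x y : G) (hgen : Subgroup.closure {x, y} = ⊤)
    (hx : x ∉ MaxClass.chi2 G)
    (hy : y ∈ MaxClass.chi2 G) (hy' : y ∉ commutator G)
    (k : ℕ) (hk : k = MaxClass.defect G)
    (I : Set ℕ) (hI : I = Set.Icc 1 (p + 1))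
    (U : ℕ → Subgroup G) (hU : U = MaxClass.U x y)
    (π : G →* G ⧸ MaxClass.gamma G (Group.nilpotencyClass G))
    (hπ : π = MaxClass.parentProj G) :
    -- the abelianization is of type `(p, p)`
    Nonempty (Abelianization G ≃* Multiplicative (ZMod p × ZMod p)) ∧
    -- `U_1, …, U_{p+1}` are the distinct maximal subgroups of `G`
    (Set.InjOn U I ∧ U '' I = {M : Subgroup G | IsCoatom M}) ∧
    -- the invariant `k` is well defined
    (k ≤ m - 4 ∧ ⁅MaxClass.chi2 G, MaxClass.gamma G 2⁆ = MaxClass.gamma G (m - k) ∧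
      ∀ l ≤ m - 4, ⁅MaxClass.chi2 G, MaxClass.gamma G 2⁆ = MaxClass.gamma G (m - l) → l = k) ∧
    -- stable components of the Artin pattern remain fixed, polarized components change
    (∀ i ∈ MaxClass.Stb π I U, MaxClass.TargetEq π U i ∧ MaxClass.KernelEq π U i) ∧
    (∀ i ∈ MaxClass.Pol π I U,
      (MaxClass.TargetPrec π U i ∧ ¬ MaxClass.TargetEq π U i) ∧ MaxClass.KernelPrec π U i) ∧
    -- unipolarization and partial stabilization
    ((∀ a ∈ U 1, ∀ b ∈ U 1, a * b = b * a) →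
      MaxClass.Pol π I U = {1} ∧ MaxClass.Stb π I U = Set.Icc 2 (p + 1)) ∧
    ((MaxClass.Pol π I U = {1} ∧ MaxClass.Stb π I U = Set.Icc 2 (p + 1)) ↔
      (⁅U 1, U 1⁆ = ⊥ ∧ k = 0)) ∧
    -- nilpolarization and total stabilization
    ((∀ i ∈ I, ¬ ∀ a ∈ U i, ∀ b ∈ U i, a * b = b * a) →
      MaxClass.Pol π I U = ∅ ∧ MaxClass.Stb π I U = Set.Icc 1 (p + 1)) ∧
    ((MaxClass.Pol π I U = ∅ ∧ MaxClass.Stb π I U = Set.Icc 1 (p + 1)) ↔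
      (⁅U 1, U 1⁆ = Subgroup.closure (MaxClass.s x y '' Set.Icc (m - k) (m - 1)) ∧
        ⁅U 1, U 1⁆ = MaxClass.gamma G (m - k) ∧ 1 ≤ k)) ∧
    -- the commutator subgroups of the other maximal subgroups
    (∀ i ∈ Set.Icc 2 (p + 1),
      ⁅U i, U i⁆ = Subgroup.closure (MaxClass.s x y '' Set.Icc 3 (m - 1)) ∧
        ⁅U i, U i⁆ = MaxClass.gamma G 3) := by
  subst hk hI hU hπ
  have h : MaxClass.IsMaximalClass p m G := ⟨hp, by omega, hcard, hclass⟩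
  have a : MaxClass.IsAdapted x y := ⟨hmetab, hgen, hx, hy, hy'⟩
  have h4 := h.four_le
  obtain ⟨hk4, hU1⟩ := a.defect_spec h
  have hchi := a.commutator_chi2_eq h
  have hbot := a.commutator_U_one_eq_bot_iff h
  have hkerU := a.ker_le_commutator_U_one_iff h
  have hker : (MaxClass.parentProj G).ker = MaxClass.gamma G (m - 1) := by
    rw [← hclass]
    exact QuotientGroup.ker_mk' _
  have hsurj : Function.Surjective (MaxClass.parentProj G) := QuotientGroup.mk'_surjective _
  have hker2 : ∀ i, (MaxClass.parentProj G).ker ≤ MaxClass.U x y i := fun i =>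
    (hker.le.trans (MaxClass.gamma_antitone (show 2 ≤ m - 1 by omega))).trans
      (MaxClass.commutator_le_U x y i)
  have hstable : ∀ i, 2 ≤ i →
      (MaxClass.parentProj G).ker ≤ ⁅MaxClass.U x y i, MaxClass.U x y i⁆ := fun i hi => by
    rw [hker, a.commutator_U_eq_gamma_three h hi]
    exact MaxClass.gamma_antitone hm
  -- The implication on the right encodes both cases: it is vacuous for `i ≥ 2` and says `k ≥ 1` for
  -- `i = 1`. Both the unipolar and the nilpolar equivalence are read off from it.
  have hstable_iff : ∀ i, 1 ≤ i →
      ((MaxClass.parentProj G).ker ≤ ⁅MaxClass.U x y i, MaxClass.U x y i⁆ ↔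
        i = 1 → 1 ≤ MaxClass.defect G) := fun i hi => by
    rcases hi.eq_or_lt with rfl | hi
    · rw [hker, hkerU]
      exact ⟨fun h1 _ => h1, fun h1 => h1 rfl⟩
    · exact iff_of_true (hstable i hi) fun h1 => by omega
  have huni : (MaxClass.Pol (MaxClass.parentProj G) (Set.Icc 1 (p + 1)) (MaxClass.U x y) = {1} ∧
      MaxClass.Stb (MaxClass.parentProj G) (Set.Icc 1 (p + 1)) (MaxClass.U x y) =
        Set.Icc 2 (p + 1)) ↔ MaxClass.defect G = 0 := by
    constructor
    · rintro ⟨hPol, -⟩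
      have h1 := (hPol.ge (Set.mem_singleton 1)).2
      rw [hstable_iff 1 le_rfl] at h1
      omega
    · intro h0
      constructor
      · ext i
        constructor
        · rintro ⟨hi, hn⟩
          rw [hstable_iff i hi.1] at hn
          rw [Set.mem_singleton_iff]
          omega
        · rintro rfl
          refine ⟨⟨le_rfl, by omega⟩, ?_⟩
          rw [hstable_iff 1 le_rfl]
          omega
      · ext i
        constructor
        · rintro ⟨hi, hs⟩
          rw [hstable_iff i hi.1] at hs
          obtain ⟨hi1, hi2⟩ := hi
          exact ⟨by omega, hi2⟩
        · rintro ⟨hi1, hi2⟩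
          exact ⟨⟨by omega, hi2⟩, hstable i hi1⟩
  have hnil : (MaxClass.Pol (MaxClass.parentProj G) (Set.Icc 1 (p + 1)) (MaxClass.U x y) = ∅ ∧
      MaxClass.Stb (MaxClass.parentProj G) (Set.Icc 1 (p + 1)) (MaxClass.U x y) =
        Set.Icc 1 (p + 1)) ↔ 1 ≤ MaxClass.defect G := by
    constructor
    · rintro ⟨-, hStb⟩
      exact (hstable_iff 1 le_rfl).1 (hStb.ge ⟨le_rfl, by omega⟩).2 rfl
    · intro h1
      constructor
      · exact Set.eq_empty_iff_forall_notMem.2 fun i hi =>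
          hi.2 ((hstable_iff i hi.1.1).2 fun _ => h1)
      · ext i
        exact ⟨fun hi => hi.1, fun hi => ⟨hi, (hstable_iff i hi.1).2 fun _ => h1⟩⟩
  refine ⟨h.abelianization_type, ⟨a.U_injOn h, a.image_U_eq h⟩,
    ⟨hk4, hchi.trans hU1, fun l hl heq => ?_⟩, fun i hi => ?_, fun i hi => ?_, fun hab => ?_, ?_,
    fun hna => ?_, ?_, fun i hi => ?_⟩
  -- The bounds `k, l ≤ m - 4` keep both indices between `4` and `m`, where the `γ_j` are pairwise
  -- distinct.
  · have := h.gamma_injOn (by omega) (by omega) (by omega) (by omega)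
      ((hchi.trans hU1).symm.trans heq)
    omega
  · exact ⟨(MaxClass.targetEq_iff _ _ i (hker2 i)).2 hi.2, MaxClass.kernelEq _ _ i hsurj hi.2⟩
  · exact ⟨⟨MaxClass.targetPrec _ _ i,
      fun ht => hi.2 ((MaxClass.targetEq_iff _ _ i (hker2 i)).1 ht)⟩,
      MaxClass.kernelPrec _ _ i hsurj (hker2 i)⟩
  · exact huni.2 (hbot.1 (MaxClass.commutator_self_eq_bot_iff_forall.2 hab))
  · rw [huni, hbot, and_self]
  · refine hnil.2 (Nat.one_le_iff_ne_zero.2 fun h0 => hna 1 ⟨le_rfl, by omega⟩ ?_)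
    exact MaxClass.commutator_self_eq_bot_iff_forall.1 (hbot.2 h0)
  · rw [hnil]
    refine ⟨fun h1 => ⟨?_, hU1, h1⟩, fun h1 => h1.2.2⟩
    rw [hU1, a.gamma_eq_closure h (by omega) (by omega)]
  · have hU3 := a.commutator_U_eq_gamma_three h hi.1
    exact ⟨by rw [hU3, a.gamma_eq_closure h (by omega) (by omega)], hU3⟩
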